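/- **Objects on the topological side.** Let $\mathbf{SkePerLC}$ be the category whose objects are all locally compact Hausdorff spaces and whose morphisms are all quasi-open perfect maps, with the usual composition. Here a map $f:X\to Y$ is *perfect* if it is continuous, closed (not necessarily onto) and all its fibres $f^{-1}(y)$, $y\in Y$, are compact, and it is *quasi-open* if it is continuous and $\operatorname{int}(f(U))\neq\emptyset$ for every non-empty open $U\subseteq X$. **Objects on the algebraic side.** A *complete local contact algebra* is a triple $(B,\rho,\mathbb{B})$ where $B$ is a complete Boolean algebra ($0=1$ is allowed; the complement of $b$ is written $b^*$), $\mathbb{B}$ is a (possibly non-proper) ideal of $B$, whose elements are called bounded, and $\rho$ is a binary relation on $B$ such that, for all $a,b,c\in B$: - if $a\neq 0$ then $a\rho a$; if $a\rho b$ then $a\ne 0$ and $b\neq 0$; if $a\rho b$ then $b\rho a$; $a\rho(b\vee c)$ iff $a\rho b$ or $a\rho c$; - writing $a\ll b$ for "not $a\rho b^*$": if $a\in\mathbb{B}$ and $a\ll c$ then $a\ll d\ll c$ for some $d\in\mathbb{B}$; if $a\rho b$ then $a\rho(d\wedge b)$ for some $d\in\mathbb{B}$; if $a\neq 0$ then there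 is $d\in\mathbb{B}\setminus\{0\}$ with $d\ll a$. Let $\mathbf{ESkePerLC}$ be the category whose objects are all complete local contact algebras and whose morphisms $\psi:(A,\rho,\mathbb{B})\to(B,\eta,\mathbb{B}')$ are all functions $\psi:A\to B$ satisfying the following conditions, with the usual composition: 1. for every $a\in A$, $\psi(a)=0$ iff $a=0$; 2. $\psi$ preserves all joins; 3. if $a\in A$, $b\in B$ and $b\le\psi(a)$, then there is $c\in A$ with $c\le a$ and $\psi(c)=b$; 4. for all $a,b\in A$, $a\rho b$ implies $\psi(a)\,\eta\,\psi(b)$; 5. if $a\in\mathbb{B}$ then $\psi(a)\in\mathbb{B}'$; 6. if $b\in\mathbb{B}'$ then $\psi_P(b)\in\mathbb{B}$, where $\psi_P:B\to A$, $\psi_P(b)=\bigvee\{a\in A\mid \psi(a)\le b\}$, is the right adjoint of $\psi$. **Theorem.** The categories $\mathbf{SkePerLC}$ and $\mathbf{ESkePerLC}$ are equivalent. -/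

import Mathlib

open CategoryTheory

universe u

/-! ### Locally compact Hausdorff spaces and quasi-open perfect maps -/

/-- The images of non-empty open sets have non-empty interior. (Continuity, which belongs to the
notion of a quasi-open map, is carried separately by the morphisms below.) -/
def IsQuasiOpen {X Y : Type u} [TopologicalSpace X] [TopologicalSpace Y] (f : X → Y) : Prop :=
  ∀ U : Set X, IsOpen U → U.Nonempty → (interior (f '' U)).Nonempty

/-- Skeletal functions. -/
def IsSkeletal {X Y : Type u} [TopologicalSpace X] [TopologicalSpace Y] (f : X → Y) : Prop :=
  ∀ V : Set Y, IsOpen V → interior (f ⁻¹' closure V) ⊆ closure (f ⁻¹' V)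

/-- For closed maps on a regular space (in particular on a locally compact Hausdorff space)
"skeletal" and "quasi-open" are the same, so that the morphisms of `SkePerLC` below are
precisely the skeletal perfect maps. -/
theorem isSkeletal_iff_isQuasiOpen {X Y : Type u} [TopologicalSpace X] [TopologicalSpace Y]
    [RegularSpace X] {f : X → Y} (hf : IsClosedMap f) : IsSkeletal f ↔ IsQuasiOpen f := by
  constructor
  · rintro h U hU ⟨x, hx⟩
    obtain ⟨C, hC, hCc, hCU⟩ := exists_mem_nhds_isClosed_subset (hU.mem_nhds hx)
    by_contra hne
    rw [Set.not_nonempty_iff_eq_empty] at hne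
    have h1 : interior (f '' C) = ∅ :=
      Set.subset_empty_iff.1 (hne ▸ interior_mono (Set.image_mono hCU))
    have h2 : closure (f '' C)ᶜ = Set.univ := by rw [closure_compl, h1, Set.compl_empty]
    have h3 := h (f '' C)ᶜ (hf C hCc).isOpen_compl
    rw [h2, Set.preimage_univ, interior_univ] at h3
    obtain ⟨z, hz, hz'⟩ := mem_closure_iff_nhds.1 (h3 (Set.mem_univ x)) C hC
    exact hz' ⟨z, hz, rfl⟩
  · intro h V hV x hx
    by_contra hn
    obtain ⟨y, hy⟩ := h (interior (f ⁻¹' closure V) ∩ (closure (f ⁻¹' V))ᶜ)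
      (isOpen_interior.inter isClosed_closure.isOpen_compl) ⟨x, hx, hn⟩
    obtain ⟨w, hw, hwV⟩ := mem_closure_iff.1
      (show y ∈ closure V by
        obtain ⟨z, hz, rfl⟩ := interior_subset hy
        exact (interior_subset hz.1 : z ∈ f ⁻¹' closure V)) _ isOpen_interior hy
    obtain ⟨t, ht, rfl⟩ := interior_subset hw
    exact ht.2 (subset_closure hwV)

/-- Perfect maps: continuous closed maps (not necessarily onto) with compact fibres. -/
structure IsPerfect {X Y : Type u} [TopologicalSpace X] [TopologicalSpace Y] (f : X → Y) :
    Prop where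
  continuous : Continuous f
  isClosedMap : IsClosedMap f
  isCompact_fiber : ∀ y : Y, IsCompact (f ⁻¹' {y})

/-- Objects of the category `SkePerLC`: locally compact Hausdorff spaces. -/
structure SkePerLC : Type (u + 1) where
  carrier : Type u
  [top : TopologicalSpace carrier]
  [locallyCompact : LocallyCompactSpace carrier]
  [t2 : T2Space carrier]

namespace SkePerLC

instance : CoeSort SkePerLC.{u} (Type u) := ⟨SkePerLC.carrier⟩

attribute [instance] SkePerLC.top SkePerLC.locallyCompact SkePerLC.t2

/-- Morphisms of `SkePerLC`: quasi-open perfect maps. -/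
@[ext]
structure Hom (X Y : SkePerLC.{u}) : Type u where
  toFun : X → Y
  isPerfect : IsPerfect toFun
  isQuasiOpen : IsQuasiOpen toFun

/-- The identity map. -/
def Hom.id (X : SkePerLC.{u}) : Hom X X where
  toFun := fun x => x
  isPerfect := ⟨continuous_id, IsClosedMap.id, fun _ => isCompact_singleton⟩
  isQuasiOpen := fun U hU hne => by simpa [hU.interior_eq] using hne

/-- Composition of maps. -/
def Hom.comp {X Y Z : SkePerLC.{u}} (f : Hom X Y) (g : Hom Y Z) : Hom X Z where
  toFun := g.toFun ∘ f.toFun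
  isPerfect := by
    have hf := isProperMap_iff_isClosedMap_and_compact_fibers.2
      ⟨f.isPerfect.continuous, f.isPerfect.isClosedMap, f.isPerfect.isCompact_fiber⟩
    have hg := isProperMap_iff_isClosedMap_and_compact_fibers.2
      ⟨g.isPerfect.continuous, g.isPerfect.isClosedMap, g.isPerfect.isCompact_fiber⟩
    obtain ⟨h1, h2, h3⟩ := isProperMap_iff_isClosedMap_and_compact_fibers.1 (hg.comp hf)
    exact ⟨h1, h2, h3⟩
  isQuasiOpen := fun U hU hne => by
    refine (g.isQuasiOpen _ isOpen_interior (f.isQuasiOpen U hU hne)).mono ?_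
    rw [Set.image_comp]
    exact interior_mono (Set.image_mono interior_subset)

instance : Category SkePerLC.{u} where
  Hom X Y := Hom X Y
  id X := Hom.id X
  comp f g := Hom.comp f g

end SkePerLC

/-! ### Complete local contact algebras -/

/-- `C` is a contact relation on the Boolean algebra `B`. -/
structure IsContactRel {B : Type u} [BooleanAlgebra B] (C : B → B → Prop) : Prop where
  refl_of_ne : ∀ a, a ≠ ⊥ → C a a
  ne_of_rel : ∀ a b, C a b → a ≠ ⊥ ∧ b ≠ ⊥
  symm : ∀ a b, C a b → C b a
  sup_iff : ∀ a b c, C a (b ⊔ c) ↔ C a b ∨ C a c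

/-- Non-tangential inclusion `a ≪ b`. -/
def NonTang {B : Type u} [BooleanAlgebra B] (C : B → B → Prop) (a b : B) : Prop :=
  ¬ C a bᶜ

/-- `(B, ρ, I)` is a local contact algebra; `I` is the (possibly non-proper) ideal of bounded
elements. -/
structure IsLocalContact {B : Type u} [BooleanAlgebra B] (ρ : B → B → Prop)
    (I : Order.Ideal B) : Prop where
  isContactRel : IsContactRel ρ
  interpolate : ∀ a c, a ∈ I → NonTang ρ a c → ∃ b ∈ I, NonTang ρ a b ∧ NonTang ρ b c
  exists_bounded : ∀ a b, ρ a b → ∃ c ∈ I, ρ a (c ⊓ b)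
  exists_nonTang : ∀ a, a ≠ ⊥ → ∃ b ∈ I, b ≠ ⊥ ∧ NonTang ρ b a

/-- Objects of the category `ESkePerLC`: complete local contact algebras. -/
structure ESkePerLC : Type (u + 1) where
  carrier : Type u
  [alg : CompleteBooleanAlgebra carrier]
  /-- the contact relation -/
  rel : carrier → carrier → Prop
  /-- the ideal of bounded elements -/
  bounded : Order.Ideal carrier
  isLocalContact : IsLocalContact rel bounded

/-- The right adjoint of a join-preserving map `ψ` between complete lattices. -/
def rightAdj {A B : Type u} [CompleteLattice A] [CompleteLattice B] (ψ : A → B) (b : B) : A :=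
  sSup {a | ψ a ≤ b}

theorem gc_rightAdj {A B : Type u} [CompleteLattice A] [CompleteLattice B] {ψ : A → B}
    (h : ∀ S : Set A, ψ (sSup S) = sSup (ψ '' S)) : GaloisConnection ψ (rightAdj ψ) := by
  have hmono : Monotone ψ := by
    intro a b hab
    have := h {a, b}
    rw [sSup_pair, sup_eq_right.2 hab, Set.image_pair, sSup_pair] at this
    rw [this]
    exact le_sup_left
  refine fun a b => ⟨fun hab => le_sSup hab, fun hab => (hmono hab).trans ?_⟩
  rw [rightAdj, h]
  exact sSup_le (by rintro _ ⟨x, hx, rfl⟩; exact hx)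

namespace ESkePerLC

instance : CoeSort ESkePerLC.{u} (Type u) := ⟨ESkePerLC.carrier⟩

attribute [instance] ESkePerLC.alg

/-- Morphisms of the category `ESkeLC`. -/
@[ext]
structure SkeHom (A B : ESkePerLC.{u}) : Type u where
  toFun : A → B
  eq_bot_iff : ∀ a, toFun a = ⊥ ↔ a = ⊥
  map_sSup : ∀ S : Set A, toFun (sSup S) = sSup (toFun '' S)
  exists_le : ∀ (a : A) (b : B), b ≤ toFun a → ∃ c, c ≤ a ∧ toFun c = b
  map_rel : ∀ a b, A.rel a b → B.rel (toFun a) (toFun b)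
  map_bounded : ∀ a, a ∈ A.bounded → toFun a ∈ B.bounded

/-- Morphisms of the category `ESkePerLC`: those of `ESkeLC` whose right adjoint preserves
boundedness. -/
@[ext]
structure Hom (A B : ESkePerLC.{u}) : Type u extends SkeHom A B where
  rightAdj_bounded : ∀ b, b ∈ B.bounded → rightAdj toFun b ∈ A.bounded

/-- The identity map. -/
def Hom.id (A : ESkePerLC.{u}) : Hom A A where
  toFun := fun a => a
  eq_bot_iff _ := Iff.rfl
  map_sSup S := by simp
  exists_le _ b h := ⟨b, h, rfl⟩
  map_rel _ _ h := h
  map_bounded _ h := h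
  rightAdj_bounded b h := by
    have : rightAdj (fun a : A => a) b = b :=
      le_antisymm (sSup_le fun _ h => h) (le_sSup le_rfl)
    rwa [this]

/-- Composition of maps. -/
def Hom.comp {A B C : ESkePerLC.{u}} (f : Hom A B) (g : Hom B C) : Hom A C where
  toFun := g.toFun ∘ f.toFun
  eq_bot_iff a := (g.eq_bot_iff _).trans (f.eq_bot_iff a)
  map_sSup S := by simp only [Function.comp, f.map_sSup, g.map_sSup, Set.image_image]
  exists_le a c h := by
    obtain ⟨b, hb, rfl⟩ := g.exists_le _ _ h
    obtain ⟨d, hd, rfl⟩ := f.exists_le _ _ hb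
    exact ⟨d, hd, rfl⟩
  map_rel a b h := g.map_rel _ _ (f.map_rel a b h)
  map_bounded a h := g.map_bounded _ (f.map_bounded a h)
  rightAdj_bounded c h := by
    have : rightAdj (g.toFun ∘ f.toFun) c = rightAdj f.toFun (rightAdj g.toFun c) := by
      unfold rightAdj
      congr 1
      ext a
      exact gc_rightAdj g.map_sSup (f.toFun a) c
    rw [this]
    exact f.rightAdj_bounded _ (g.rightAdj_bounded c h)

instance : Category ESkePerLC.{u} where
  Hom A B := Hom A B
  id A := Hom.id A
  comp f g := Hom.comp f g

end ESkePerLC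

open Set Topology

/-! ### The complete Boolean algebra of regular closed sets -/

section ClosureInterior

variable {X : Type*} [TopologicalSpace X]

/-! The regular closed sets of a locally compact Hausdorff space `X` form a complete local contact
algebra: contact means intersecting, bounded means compact. A quasi-open perfect map carries regular
closed sets to regular closed sets, and direct image is a covariant functor `regularClosedFunctor`.
It is shown to be faithful, full and essentially surjective.

Fullness. Given `ψ` between algebras of regular closed sets, the image of `x` should be the point
common to all `ψ(F)`, where `F` runs over the regular closed neighbourhoods of `x`. Such a point
exists because `ψ(F)` is compact for compact `F`. It is unique because `x` lies in the right adjoint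
`ψ_P(V)` for every neighbourhood `V` of the point, while `ψ` preserves contact
(`eq_of_forall_mem_adj`). Condition 3 together with compactness of `ψ_P(V)` gives `image_pointMap`:
the point map has `ψ` as its direct image.

Essential surjectivity. A point `x` is recovered from the filter of regular closed sets having `x`
in their interior; `LocalEnd` axiomatizes such filters. The closure of the basic open set of `a` is
the set of ends not containing `aᶜ`. A prime ideal argument supplies enough ends for this assignment
to reflect order and contact (`adherent_subset_iff`, `rel_iff`), it matches boundedness with
compactness (`isCompact_adherent_iff`), and completeness of the algebra makes it onto
(`regularClosed_surjective`). -/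

theorem IsClosed.interior_union_subset {A B : Set X} (hB : IsClosed B) :
    interior (A ∪ B) ⊆ closure (interior A) ∪ B := by
  intro x hx
  by_cases hxB : x ∈ B
  · exact Or.inr hxB
  · refine Or.inl (subset_closure ?_)
    refine mem_interior.2 ⟨interior (A ∪ B) ∩ Bᶜ, ?_, isOpen_interior.inter hB.isOpen_compl,
      hx, hxB⟩
    rintro z ⟨hz, hzB⟩
    exact (interior_subset hz).resolve_right hzB

/-- Away from the closure of `interior A`, the open set `interior (A ∪ B)` lies inside `B`, hence
inside its interior. This makes unions the binary joins and also yields distributivity. -/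
theorem closure_interior_union {A B : Set X} (hB : IsClosed B) :
    closure (interior (A ∪ B)) = closure (interior A) ∪ closure (interior B) := by
  apply Subset.antisymm
  · refine closure_minimal ?_ (isClosed_closure.union isClosed_closure)
    intro x hx
    by_cases h : x ∈ closure (interior A)
    · exact Or.inl h
    · refine Or.inr (subset_closure (mem_interior.2 ⟨interior (A ∪ B) ∩ (closure (interior A))ᶜ,
        ?_, isOpen_interior.inter isClosed_closure.isOpen_compl, hx, h⟩))
      rintro z ⟨hz, hzA⟩
      exact (hB.interior_union_subset hz).resolve_left hzA
  · exact union_subset (closure_mono (interior_mono subset_union_left))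
      (closure_mono (interior_mono subset_union_right))

end ClosureInterior

/-- The regular closed subsets of a topological space. -/
@[ext]
structure RegularClosed (X : Type u) [TopologicalSpace X] : Type u where
  /-- the underlying set -/
  carrier : Set X
  closure_interior' : closure (interior carrier) = carrier

namespace RegularClosed

section Basic

variable {X : Type u} [TopologicalSpace X]

instance : SetLike (RegularClosed X) X where
  coe := RegularClosed.carrier
  coe_injective _ _ h := RegularClosed.ext h

theorem closure_interior (F : RegularClosed X) : closure (interior (F : Set X)) = F :=
  F.closure_interior'

theorem isClosed (F : RegularClosed X) : IsClosed (F : Set X) :=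
  F.closure_interior ▸ isClosed_closure

/-- The closure of an open set. -/
def ofOpen (U : Set X) (hU : IsOpen U) : RegularClosed X where
  carrier := closure U
  closure_interior' := Subset.antisymm isClosed_closure.closure_interior_subset
    (closure_mono hU.subset_interior_closure)

@[simp] theorem coe_ofOpen (U : Set X) (hU : IsOpen U) : (ofOpen U hU : Set X) = closure U := rfl

/-- The closure of the interior of a set. -/
def reg (A : Set X) : RegularClosed X := ofOpen (interior A) isOpen_interior

@[simp] theorem coe_reg (A : Set X) : (reg A : Set X) = closure (interior A) := rfl

instance : PartialOrder (RegularClosed X) := PartialOrder.ofSetLike (RegularClosed X) X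

theorem le_iff {F G : RegularClosed X} : F ≤ G ↔ (F : Set X) ⊆ G := Iff.rfl

theorem le_of_interior_subset {F G : RegularClosed X} (h : interior (F : Set X) ⊆ G) : F ≤ G := by
  rw [le_iff, ← F.closure_interior]
  exact closure_minimal h G.isClosed

theorem le_reg {F : RegularClosed X} {A : Set X} (h : (F : Set X) ⊆ A) : F ≤ reg A := by
  rw [le_iff, ← F.closure_interior, coe_reg]
  exact closure_mono (interior_mono h)

theorem reg_subset {A : Set X} (hA : IsClosed A) : (reg A : Set X) ⊆ A :=
  hA.closure_interior_subset

instance : SupSet (RegularClosed X) where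
  sSup S := ofOpen (⋃ F ∈ S, interior (F : Set X))
    (isOpen_biUnion fun _ _ => isOpen_interior)

theorem coe_sSup_eq_closure_interior (S : Set (RegularClosed X)) :
    ((sSup S : RegularClosed X) : Set X) = closure (⋃ F ∈ S, interior (F : Set X)) := rfl

theorem isLUB_sSup (S : Set (RegularClosed X)) : IsLUB S (sSup S) := by
  constructor
  · intro F hF
    apply le_of_interior_subset
    rw [coe_sSup_eq_closure_interior]
    exact (subset_biUnion_of_mem (u := fun F : RegularClosed X => interior (F : Set X)) hF).trans
      subset_closure
  · intro G hG
    rw [le_iff, coe_sSup_eq_closure_interior]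
    refine closure_minimal (iUnion₂_subset fun F hF => ?_) G.isClosed
    exact interior_subset.trans (hG hF)

instance : CompleteLattice (RegularClosed X) where
  __ := completeLatticeOfSup (RegularClosed X) isLUB_sSup
  sup F G :=
    { carrier := F ∪ G
      closure_interior' := by
        rw [_root_.closure_interior_union G.isClosed, F.closure_interior,
          G.closure_interior] }
  le_sup_left F G := le_iff.2 (subset_union_left (s := (F : Set X)))
  le_sup_right F G := le_iff.2 (subset_union_right (t := (G : Set X)))
  sup_le _ _ _ h h' := le_iff.2 (union_subset (le_iff.1 h) (le_iff.1 h'))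
  inf F G := reg (F ∩ G)
  inf_le_left F G := le_iff.2 ((reg_subset (F.isClosed.inter G.isClosed)).trans inter_subset_left)
  inf_le_right F G := le_iff.2 ((reg_subset (F.isClosed.inter G.isClosed)).trans inter_subset_right)
  le_inf _ _ _ h h' := le_reg (subset_inter h h')
  top := ⟨univ, by simp⟩
  le_top F := le_iff.2 (subset_univ (F : Set X))
  bot := ⟨∅, by simp⟩
  bot_le F := le_iff.2 (empty_subset (F : Set X))

@[simp] theorem coe_sup (F G : RegularClosed X) :
    ((F ⊔ G : RegularClosed X) : Set X) = (F : Set X) ∪ G :=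
  rfl

@[simp] theorem coe_inf (F G : RegularClosed X) :
    ((F ⊓ G : RegularClosed X) : Set X) = closure (interior ((F : Set X) ∩ G)) := rfl

@[simp] theorem coe_bot : ((⊥ : RegularClosed X) : Set X) = ∅ := rfl

instance : CompleteBooleanAlgebra (RegularClosed X) where
  __ := (inferInstance : CompleteLattice (RegularClosed X))
  le_sup_inf F G H := by
    rw [le_iff, coe_inf, coe_sup, coe_sup, coe_sup, coe_inf, ← union_inter_distrib_left,
      _root_.closure_interior_union (G.isClosed.inter H.isClosed), F.closure_interior]
  compl F := ofOpen (F : Set X)ᶜ F.isClosed.isOpen_compl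
  inf_compl_le_bot F := by
    rw [le_iff, coe_inf, interior_inter, coe_ofOpen, coe_bot, closure_compl, subset_empty_iff,
      closure_empty_iff, ← disjoint_iff_inter_eq_empty]
    exact disjoint_compl_right.mono_right interior_subset
  top_le_sup_compl F := by
    rw [le_iff, coe_sup, coe_ofOpen]
    intro x _
    by_cases hx : x ∈ (F : Set X)
    · exact Or.inl hx
    · exact Or.inr (subset_closure hx)
  le_top _ := le_top
  bot_le _ := bot_le

theorem coe_compl (F : RegularClosed X) :
    ((Fᶜ : RegularClosed X) : Set X) = (interior (F : Set X))ᶜ :=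
  closure_compl

theorem ne_bot_iff {F : RegularClosed X} : F ≠ ⊥ ↔ (F : Set X).Nonempty := by
  rw [nonempty_iff_ne_empty, ne_eq, ne_eq, ← coe_bot, SetLike.coe_set_eq]

theorem interior_nonempty {F : RegularClosed X} (h : F ≠ ⊥) : (interior (F : Set X)).Nonempty := by
  rw [← closure_nonempty_iff, F.closure_interior]
  exact ne_bot_iff.1 h

theorem coe_sSup (S : Set (RegularClosed X)) :
    ((sSup S : RegularClosed X) : Set X) = closure (⋃ F ∈ S, (F : Set X)) := by
  apply Subset.antisymm
  · exact closure_mono (iUnion₂_mono fun F _ => interior_subset)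
  · exact closure_minimal (iUnion₂_subset fun F hF => le_iff.1 (le_sSup hF)) (sSup S).isClosed

/-- The meet can be smaller than the intersection, since sets touching along boundaries may have
meet `⊥`; one interior membership already prevents the loss. -/
theorem mem_inf_of_mem_interior {F G : RegularClosed X} {x : X} (hF : x ∈ interior (F : Set X))
    (hG : x ∈ G) : x ∈ F ⊓ G := by
  rw [← SetLike.mem_coe, coe_inf, interior_inter]
  apply isOpen_interior.inter_closure
  rw [G.closure_interior]
  exact ⟨hF, hG⟩

theorem mem_interior_inf {F G : RegularClosed X} {x : X} (hF : x ∈ interior (F : Set X))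
    (hG : x ∈ interior (G : Set X)) : x ∈ interior ((F ⊓ G : RegularClosed X) : Set X) := by
  rw [coe_inf, interior_inter]
  exact (isOpen_interior.inter isOpen_interior).subset_interior_closure ⟨hF, hG⟩

theorem mem_of_mem_inf_left {F G : RegularClosed X} {x : X} (h : x ∈ F ⊓ G) : x ∈ F :=
  le_iff.1 (inf_le_left : F ⊓ G ≤ F) h

theorem mem_of_mem_inf_right {F G : RegularClosed X} {x : X} (h : x ∈ F ⊓ G) : x ∈ G :=
  le_iff.1 (inf_le_right : F ⊓ G ≤ G) h

theorem interior_subset_interior_reg (A : Set X) : interior A ⊆ interior (reg A : Set X) :=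
  isOpen_interior.subset_interior_closure

/-- The contact relation on regular closed sets. -/
def Meets (F G : RegularClosed X) : Prop := ((F : Set X) ∩ G).Nonempty

theorem nonTang_meets {F G : RegularClosed X} :
    NonTang Meets F G ↔ (F : Set X) ⊆ interior (G : Set X) := by
  rw [NonTang, Meets, coe_compl, not_nonempty_iff_eq_empty, ← disjoint_iff_inter_eq_empty,
    disjoint_compl_right_iff_subset]

theorem isContactRel_meets : IsContactRel (Meets (X := X)) where
  refl_of_ne F h := by rwa [Meets, inter_self, ← ne_bot_iff]
  ne_of_rel _ _ h := ⟨ne_bot_iff.2 h.left, ne_bot_iff.2 h.right⟩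
  symm F G h := by rwa [Meets, inter_comm]
  sup_iff F G H := by rw [Meets, coe_sup, inter_union_distrib_left, union_nonempty]; rfl

variable (X) in
/-- The ideal of compact regular closed sets. -/
def compacts [T2Space X] : Order.Ideal (RegularClosed X) where
  carrier := {F | IsCompact (F : Set X)}
  lower' _ G h hF := hF.of_isClosed_subset G.isClosed h
  nonempty' := ⟨⊥, isCompact_empty⟩
  directed' F hF G hG := ⟨F ⊔ G, hF.union hG, le_sup_left, le_sup_right⟩

end Basic

/-! ### Compact regular closed neighbourhoods. -/

section LocallyCompact

variable {X : Type u} [TopologicalSpace X] [LocallyCompactSpace X] [T2Space X]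

theorem exists_compact_between {K U : Set X} (hK : IsCompact K) (hU : IsOpen U) (h : K ⊆ U) :
    ∃ F : RegularClosed X, IsCompact (F : Set X) ∧ K ⊆ interior (F : Set X) ∧ (F : Set X) ⊆ U := by
  obtain ⟨L, hL, hKL, hLU⟩ := _root_.exists_compact_between hK hU h
  have hs := reg_subset hL.isClosed
  exact ⟨reg L, hL.of_isClosed_subset (reg L).isClosed hs,
    hKL.trans (interior_subset_interior_reg L), hs.trans hLU⟩

theorem exists_compact_mem {x : X} {U : Set X} (hU : IsOpen U) (h : x ∈ U) :
    ∃ F : RegularClosed X, IsCompact (F : Set X) ∧ x ∈ interior (F : Set X) ∧ (F : Set X) ⊆ U := by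
  obtain ⟨F, h1, h2, h3⟩ :=
    exists_compact_between isCompact_singleton hU (singleton_subset_iff.2 h)
  exact ⟨F, h1, singleton_subset_iff.1 h2, h3⟩

theorem exists_compact_nhd (x : X) :
    ∃ F : RegularClosed X, IsCompact (F : Set X) ∧ x ∈ interior (F : Set X) :=
  let ⟨F, h1, h2, _⟩ := exists_compact_mem isOpen_univ (mem_univ x)
  ⟨F, h1, h2⟩

theorem exists_disjoint {F : RegularClosed X} {x : X} (hx : x ∉ F) :
    ∃ V : RegularClosed X, IsCompact (V : Set X) ∧ x ∈ interior (V : Set X) ∧ ¬ Meets F V := by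
  obtain ⟨V, h1, h2, h3⟩ := exists_compact_mem F.isClosed.isOpen_compl hx
  exact ⟨V, h1, h2, fun ⟨z, hz, hz'⟩ => h3 hz' hz⟩

theorem isLocalContact_meets : IsLocalContact (Meets (X := X)) (compacts X) where
  isContactRel := isContactRel_meets
  interpolate F G hF h := by
    obtain ⟨H, h1, h2, h3⟩ := exists_compact_between hF isOpen_interior (nonTang_meets.1 h)
    exact ⟨H, h1, nonTang_meets.2 h2, nonTang_meets.2 h3⟩
  exists_bounded F G := by
    rintro ⟨x, hF, hG⟩
    obtain ⟨V, hV, hx⟩ := exists_compact_nhd x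
    exact ⟨V, hV, x, hF, mem_inf_of_mem_interior hx hG⟩
  exists_nonTang F hF := by
    obtain ⟨x, hx⟩ := interior_nonempty hF
    obtain ⟨V, hV, hxV, hVF⟩ := exists_compact_mem isOpen_interior hx
    exact ⟨V, hV, ne_bot_iff.2 ⟨x, interior_subset hxV⟩, nonTang_meets.2 hVF⟩

end LocallyCompact

end RegularClosed

/-- The complete local contact algebra of regular closed sets of a locally compact Hausdorff
space. -/
abbrev SkePerLC.regularClosed (X : SkePerLC.{u}) : ESkePerLC.{u} where
  carrier := RegularClosed X
  rel := RegularClosed.Meets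
  bounded := RegularClosed.compacts X
  isLocalContact := RegularClosed.isLocalContact_meets

/-! ### The functor of regular closed sets -/

namespace SkePerLC.Hom

variable {X Y : SkePerLC.{u}} (f : Hom X Y)

theorem isProperMap : IsProperMap f.toFun :=
  isProperMap_iff_isClosedMap_and_compact_fibers.2
    ⟨f.isPerfect.continuous, f.isPerfect.isClosedMap, f.isPerfect.isCompact_fiber⟩

theorem image_closure (A : Set X) : f.toFun '' closure A = closure (f.toFun '' A) :=
  (f.isPerfect.isClosedMap.closure_image_eq_of_continuous f.isPerfect.continuous A).symm

/-- Quasi-openness is applied to `U ∩ f⁻¹(W)` for every neighbourhood `W` of an image point, so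
interior points of the image occur arbitrarily near it. -/
theorem image_subset_closure_interior {U : Set X} (hU : IsOpen U) :
    f.toFun '' U ⊆ closure (interior (f.toFun '' U)) := by
  rintro _ ⟨x, hx, rfl⟩
  rw [mem_closure_iff]
  intro W hW hxW
  obtain ⟨y, hy⟩ := f.isQuasiOpen (U ∩ f.toFun ⁻¹' W)
    (hU.inter (hW.preimage f.isPerfect.continuous)) ⟨x, hx, hxW⟩
  obtain ⟨z, hz, rfl⟩ := interior_subset hy
  exact ⟨_, hz.2, interior_mono (image_mono inter_subset_left) hy⟩

/-- The direct image of regular closed sets under a quasi-open perfect map. -/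
def image (F : RegularClosed X) : RegularClosed Y where
  carrier := f.toFun '' F
  closure_interior' := by
    apply Subset.antisymm
    · exact (f.isPerfect.isClosedMap _ F.isClosed).closure_interior_subset
    · conv_lhs => rw [← F.closure_interior, f.image_closure]
      refine closure_minimal ((f.image_subset_closure_interior isOpen_interior).trans ?_)
        isClosed_closure
      exact closure_mono (interior_mono (image_mono interior_subset))

@[simp] theorem coe_image (F : RegularClosed X) : (f.image F : Set Y) = f.toFun '' F := rfl

theorem image_sSup (S : Set (RegularClosed X)) : f.image (sSup S) = sSup (f.image '' S) := by
  apply SetLike.coe_injective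
  rw [coe_image, RegularClosed.coe_sSup, RegularClosed.coe_sSup, f.image_closure, image_iUnion₂,
    biUnion_image]
  rfl

theorem image_exists_le (F : RegularClosed X) (G : RegularClosed Y) (h : G ≤ f.image F) :
    ∃ H, H ≤ F ∧ f.image H = G := by
  -- `F ∩ f⁻¹(G)` need not be regular closed; the closure of this open set is, and it still maps
  -- onto `G`.
  have hU : IsOpen (interior (F : Set X) ∩ f.toFun ⁻¹' interior (G : Set Y)) :=
    isOpen_interior.inter (isOpen_interior.preimage f.isPerfect.continuous)
  refine ⟨RegularClosed.ofOpen _ hU, ?_, ?_⟩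
  · exact RegularClosed.le_iff.2
      (closure_minimal (inter_subset_left.trans interior_subset) F.isClosed)
  · apply SetLike.coe_injective
    rw [coe_image, RegularClosed.coe_ofOpen, f.image_closure]
    apply Subset.antisymm
    · refine closure_minimal ?_ G.isClosed
      rintro _ ⟨x, hx, rfl⟩
      exact interior_subset hx.2
    · conv_lhs => rw [← G.closure_interior]
      refine closure_minimal (fun y hy => ?_) isClosed_closure
      obtain ⟨x, hx, rfl⟩ := RegularClosed.le_iff.1 h (interior_subset hy)
      rw [← f.image_closure]
      refine ⟨x, ?_, rfl⟩
      rw [SetLike.mem_coe, ← SetLike.mem_coe, ← F.closure_interior] at hx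
      exact (isOpen_interior.preimage f.isPerfect.continuous).closure_inter ⟨hx, hy⟩

/-- The adjoint is contained in `f⁻¹(G)`, which is compact because `f` is proper. -/
theorem rightAdj_image_compact (G : RegularClosed Y) (hG : IsCompact (G : Set Y)) :
    IsCompact ((rightAdj f.image G : RegularClosed X) : Set X) := by
  refine (f.isProperMap.isCompact_preimage hG).of_isClosed_subset (RegularClosed.isClosed _) ?_
  rw [rightAdj, RegularClosed.coe_sSup]
  refine closure_minimal (iUnion₂_subset fun F hF => ?_)
    (G.isClosed.preimage f.isPerfect.continuous)
  exact image_subset_iff.1 (RegularClosed.le_iff.1 hF)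

/-- The morphism of complete local contact algebras given by direct images. -/
def regularClosed : ESkePerLC.Hom X.regularClosed Y.regularClosed where
  toFun := f.image
  eq_bot_iff F := by
    rw [← not_iff_not]
    exact (RegularClosed.ne_bot_iff.trans image_nonempty).trans RegularClosed.ne_bot_iff.symm
  map_sSup := f.image_sSup
  exists_le := f.image_exists_le
  map_rel := by
    rintro F G ⟨x, hF, hG⟩
    exact ⟨f.toFun x, ⟨x, hF, rfl⟩, ⟨x, hG, rfl⟩⟩
  map_bounded _ hF := hF.image f.isPerfect.continuous
  rightAdj_bounded := f.rightAdj_image_compact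

end SkePerLC.Hom

/-- The functor assigning to a locally compact Hausdorff space its complete local contact algebra
of regular closed sets and to a map its direct image. -/
def regularClosedFunctor : SkePerLC.{u} ⥤ ESkePerLC.{u} where
  obj X := X.regularClosed
  map f := SkePerLC.Hom.regularClosed f
  map_id X := by
    refine ESkePerLC.Hom.ext (funext fun F => ?_)
    exact SetLike.coe_injective (image_id (F : Set X))
  map_comp f g := by
    refine ESkePerLC.Hom.ext (funext fun F => ?_)
    exact SetLike.coe_injective (image_comp g.toFun f.toFun (F : Set _))

theorem regularClosedFunctor_faithful : regularClosedFunctor.{u}.Faithful where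
  map_injective {X Y f g} h := by
    refine SkePerLC.Hom.ext (funext fun x => ?_)
    have h' : SkePerLC.Hom.image f = SkePerLC.Hom.image g :=
      congrArg (fun k : ESkePerLC.Hom X.regularClosed Y.regularClosed => k.toFun) h
    by_contra hne
    obtain ⟨U, V, hU, hV, hxU, hxV, hUV⟩ := t2_separation hne
    obtain ⟨F, -, hxF, hF⟩ := RegularClosed.exists_compact_mem (x := x)
      ((hU.preimage f.isPerfect.continuous).inter (hV.preimage g.isPerfect.continuous)) ⟨hxU, hxV⟩
    have hx : f.toFun x ∈ SkePerLC.Hom.image g F := h' ▸ ⟨x, interior_subset hxF, rfl⟩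
    obtain ⟨z, hz, hzx⟩ := hx
    exact disjoint_left.1 hUV hxU (hzx ▸ (hF hz).2)

/-! ### Fullness: the map induced by a morphism of algebras of regular closed sets -/

theorem ESkePerLC.SkeHom.mono {A B : ESkePerLC.{u}} (ψ : SkeHom A B) : Monotone ψ.toFun :=
  (gc_rightAdj ψ.map_sSup).monotone_l

section InducedMap

variable {X Y : SkePerLC.{u}} (ψ : ESkePerLC.Hom X.regularClosed Y.regularClosed)

namespace ESkePerLC.Hom

/-- The right adjoint of a morphism between algebras of regular closed sets. -/
def adj (V : RegularClosed Y) : RegularClosed X := rightAdj ψ.toFun V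

/-- A morphism between algebras of regular closed sets as a map of regular closed sets. -/
def onRegularClosed (F : RegularClosed X) : RegularClosed Y := ψ.toFun F

theorem onRegularClosed_mono : Monotone ψ.onRegularClosed := ψ.toSkeHom.mono

theorem gc_adj : GaloisConnection ψ.onRegularClosed (adj ψ) := gc_rightAdj ψ.map_sSup

theorem onRegularClosed_ne_bot {F : RegularClosed X} : ψ.onRegularClosed F ≠ ⊥ ↔ F ≠ ⊥ :=
  not_congr (ψ.eq_bot_iff F)

theorem isCompact_onRegularClosed {F : RegularClosed X} (hF : IsCompact (F : Set X)) :
    IsCompact (ψ.onRegularClosed F : Set Y) :=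
  ψ.map_bounded F hF

theorem isCompact_adj {V : RegularClosed Y} (hV : IsCompact (V : Set Y)) :
    IsCompact (adj ψ V : Set X) :=
  ψ.rightAdj_bounded V hV

/-- Condition 3 lifts the nonzero meet of `V` and `ψ(F)` to some `H ≤ F`, and adjunction places `H`
below `ψ_P(V)`. -/
theorem inf_adj_ne_bot {F : RegularClosed X} {V : RegularClosed Y} {y : Y}
    (hF : y ∈ ψ.onRegularClosed F)
    (hV : y ∈ interior (V : Set Y)) : F ⊓ adj ψ V ≠ ⊥ := by
  obtain ⟨H, hHF, hH⟩ := ψ.exists_le F (V ⊓ ψ.onRegularClosed F : RegularClosed Y) inf_le_right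
  replace hH : ψ.onRegularClosed H = V ⊓ ψ.onRegularClosed F := hH
  have hne : ψ.onRegularClosed H ≠ ⊥ := by
    rw [hH]
    exact RegularClosed.ne_bot_iff.2 ⟨y, RegularClosed.mem_inf_of_mem_interior hV hF⟩
  have hHV : H ≤ adj ψ V := (ψ.gc_adj H V).1 (hH ▸ inf_le_left)
  exact ne_bot_of_le_ne_bot (ψ.onRegularClosed_ne_bot.1 hne) (le_inf hHF hHV)

theorem meets_of_mem_adj {x : X} {F : RegularClosed X} {V : RegularClosed Y} (h : x ∈ F)
    (h' : x ∈ adj ψ V) : RegularClosed.Meets (ψ.onRegularClosed F) V := by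
  obtain ⟨y, hy, hy'⟩ := ψ.map_rel _ _ (⟨x, h, h'⟩ : RegularClosed.Meets F (adj ψ V))
  exact ⟨y, hy, RegularClosed.le_iff.1 ((ψ.gc_adj).l_u_le V) hy'⟩

/-- `y` lies in the image of every regular closed neighbourhood of `x`. -/
def IsImage (x : X) (y : Y) : Prop :=
  ∀ F : RegularClosed X, x ∈ interior (F : Set X) → y ∈ ψ.onRegularClosed F

variable {ψ}

theorem IsImage.mem_adj {x : X} {y : Y} (h : IsImage ψ x y) {V : RegularClosed Y}
    (hV : y ∈ interior (V : Set Y)) : x ∈ adj ψ V := by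
  by_contra hx
  obtain ⟨F, -, hxF, hF⟩ := RegularClosed.exists_disjoint hx
  obtain ⟨z, hz⟩ := RegularClosed.ne_bot_iff.1 (ψ.inf_adj_ne_bot (h F hxF) hV)
  exact hF ⟨z, RegularClosed.mem_of_mem_inf_right hz, RegularClosed.mem_of_mem_inf_left hz⟩

theorem eq_of_forall_mem_adj {x : X} {y y' : Y}
    (h : ∀ V : RegularClosed Y, IsCompact (V : Set Y) → y ∈ interior (V : Set Y) → x ∈ adj ψ V)
    (h' : ∀ V : RegularClosed Y, IsCompact (V : Set Y) → y' ∈ interior (V : Set Y) → x ∈ adj ψ V) :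
    y = y' := by
  by_contra hne
  obtain ⟨U, U', hU, hU', hyU, hyU', hd⟩ := t2_separation hne
  obtain ⟨V, hVc, hyV, hVU⟩ := RegularClosed.exists_compact_mem hU hyU
  obtain ⟨V', hVc', hyV', hVU'⟩ := RegularClosed.exists_compact_mem hU' hyU'
  obtain ⟨z, hz, hz'⟩ := ψ.meets_of_mem_adj (h V hVc hyV) (h' V' hVc' hyV')
  exact disjoint_left.1 hd (hVU (RegularClosed.le_iff.1 ((ψ.gc_adj).l_u_le V) hz)) (hVU' hz')

theorem IsImage.unique {x : X} {y y' : Y} (h : IsImage ψ x y) (h' : IsImage ψ x y') : y = y' :=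
  eq_of_forall_mem_adj (fun _ _ hV => h.mem_adj hV) (fun _ _ hV => h'.mem_adj hV)

/-- Compactness argument with a parameter: `K = univ` gives existence of the image point, and `K`
the complement of an open set gives continuity. -/
theorem exists_isImage_mem {x : X} {K : Set Y} (hK : IsClosed K)
    (h : ∀ F : RegularClosed X, x ∈ interior (F : Set X) →
      ((ψ.onRegularClosed F : Set Y) ∩ K).Nonempty) :
    ∃ y ∈ K, IsImage ψ x y := by
  let ι := {F : RegularClosed X // IsCompact (F : Set X) ∧ x ∈ interior (F : Set X)}
  obtain ⟨F₀, hF₀⟩ := RegularClosed.exists_compact_nhd x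
  have : Nonempty ι := ⟨⟨F₀, hF₀⟩⟩
  have hinf (F G : RegularClosed X) (hF : IsCompact (F : Set X)) (hx : x ∈ interior (F : Set X))
      (hx' : x ∈ interior (G : Set X)) :
      IsCompact ((F ⊓ G : RegularClosed X) : Set X) ∧
        x ∈ interior ((F ⊓ G : RegularClosed X) : Set X) :=
    ⟨hF.of_isClosed_subset (RegularClosed.isClosed _) (RegularClosed.le_iff.1 inf_le_left),
      RegularClosed.mem_interior_inf hx hx'⟩
  obtain ⟨y, hy⟩ := IsCompact.nonempty_iInter_of_directed_nonempty_isCompact_isClosed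
    (fun F : ι => (ψ.onRegularClosed F.1 : Set Y) ∩ K)
    (fun F G => ⟨⟨F.1 ⊓ G.1, hinf _ _ F.2.1 F.2.2 G.2.2⟩,
      inter_subset_inter_left _ (RegularClosed.le_iff.1 (ψ.onRegularClosed_mono inf_le_left)),
      inter_subset_inter_left _ (RegularClosed.le_iff.1 (ψ.onRegularClosed_mono inf_le_right))⟩)
    (fun F => h F.1 F.2.2)
    (fun F => (ψ.isCompact_onRegularClosed F.2.1).inter_right hK)
    (fun F => (ψ.onRegularClosed F.1).isClosed.inter hK)
  rw [mem_iInter] at hy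
  refine ⟨y, (hy ⟨F₀, hF₀⟩).2, fun F hF => ?_⟩
  exact RegularClosed.le_iff.1 (ψ.onRegularClosed_mono inf_le_right)
    (hy ⟨F₀ ⊓ F, hinf _ _ hF₀.1 hF₀.2 hF⟩).1

variable (ψ)

theorem exists_isImage (x : X) : ∃ y, IsImage ψ x y := by
  obtain ⟨y, -, hy⟩ := exists_isImage_mem (ψ := ψ) (x := x) isClosed_univ fun F hF => by
    rw [inter_univ, ← RegularClosed.ne_bot_iff, ψ.onRegularClosed_ne_bot]
    exact RegularClosed.ne_bot_iff.2 ⟨x, interior_subset hF⟩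
  exact ⟨y, hy⟩

/-- The point map induced by a morphism between algebras of regular closed sets. -/
noncomputable def pointMap (x : X) : Y := (ψ.exists_isImage x).choose

theorem isImage_pointMap (x : X) : IsImage ψ x (ψ.pointMap x) := (ψ.exists_isImage x).choose_spec

theorem continuous_pointMap : Continuous ψ.pointMap := by
  refine continuous_iff_continuousAt.2 fun x => ?_
  rw [ContinuousAt, tendsto_nhds]
  intro W hW hxW
  have : ∃ F : RegularClosed X, x ∈ interior (F : Set X) ∧ (ψ.onRegularClosed F : Set Y) ⊆ W := by
    by_contra! hcon
    obtain ⟨y, hyW, hy⟩ := exists_isImage_mem (ψ := ψ) (x := x) hW.isClosed_compl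
      fun F hF => not_subset.1 (hcon F hF)
    exact hyW (hy.unique (ψ.isImage_pointMap x) ▸ hxW)
  obtain ⟨F, hxF, hF⟩ := this
  filter_upwards [isOpen_interior.mem_nhds hxF] with z hz
  exact hF (ψ.isImage_pointMap z F hz)

theorem image_pointMap (F : RegularClosed X) : ψ.pointMap '' F = ψ.onRegularClosed F := by
  apply Subset.antisymm
  · rintro _ ⟨x, hx, rfl⟩
    by_contra hy
    obtain ⟨V, -, hyV, hV⟩ := RegularClosed.exists_disjoint hy
    exact hV (ψ.meets_of_mem_adj hx ((ψ.isImage_pointMap x).mem_adj hyV))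
  -- A preimage of `y` in `F` is found in the intersection of the compact sets `F ∩ ψ_P(V)`, for `V`
  -- a compact neighbourhood of `y`.
  · intro y hy
    let ι := {V : RegularClosed Y // IsCompact (V : Set Y) ∧ y ∈ interior (V : Set Y)}
    obtain ⟨V₀, hV₀⟩ := RegularClosed.exists_compact_nhd y
    have : Nonempty ι := ⟨⟨V₀, hV₀⟩⟩
    have hmono := (ψ.gc_adj).monotone_u
    obtain ⟨x, hx⟩ := IsCompact.nonempty_iInter_of_directed_nonempty_isCompact_isClosed
      (fun V : ι => (F : Set X) ∩ adj ψ V.1)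
      (fun V W => ⟨⟨V.1 ⊓ W.1, V.2.1.of_isClosed_subset (RegularClosed.isClosed _)
          (RegularClosed.le_iff.1 inf_le_left), RegularClosed.mem_interior_inf V.2.2 W.2.2⟩,
        inter_subset_inter_right _ (RegularClosed.le_iff.1 (hmono inf_le_left)),
        inter_subset_inter_right _ (RegularClosed.le_iff.1 (hmono inf_le_right))⟩)
      (fun V => by
        obtain ⟨z, hz⟩ := RegularClosed.ne_bot_iff.1 (ψ.inf_adj_ne_bot hy V.2.2)
        exact ⟨z, RegularClosed.mem_of_mem_inf_left hz, RegularClosed.mem_of_mem_inf_right hz⟩)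
      (fun V => (ψ.isCompact_adj V.2.1).inter_left F.isClosed)
      (fun V => F.isClosed.inter (adj ψ V.1).isClosed)
    rw [mem_iInter] at hx
    exact ⟨x, (hx ⟨V₀, hV₀⟩).1, eq_of_forall_mem_adj
      (fun _ _ hV => (ψ.isImage_pointMap x).mem_adj hV) (fun V hV hV' => (hx ⟨V, hV, hV'⟩).2)⟩

theorem isProperMap_pointMap : IsProperMap ψ.pointMap := by
  refine isProperMap_iff_isCompact_preimage.2 ⟨ψ.continuous_pointMap, fun K hK => ?_⟩
  obtain ⟨V, hV, hKV, -⟩ := RegularClosed.exists_compact_between hK isOpen_univ (subset_univ K)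
  refine (ψ.isCompact_adj hV).of_isClosed_subset (hK.isClosed.preimage ψ.continuous_pointMap) ?_
  exact fun x hx => (ψ.isImage_pointMap x).mem_adj (hKV hx)

theorem isQuasiOpen_pointMap : IsQuasiOpen ψ.pointMap := by
  rintro U hU ⟨x, hx⟩
  obtain ⟨F, -, hxF, hFU⟩ := RegularClosed.exists_compact_mem hU hx
  have hF : ψ.onRegularClosed F ≠ ⊥ :=
    ψ.onRegularClosed_ne_bot.2 (RegularClosed.ne_bot_iff.2 ⟨x, interior_subset hxF⟩)
  refine (RegularClosed.interior_nonempty hF).mono (interior_mono ?_)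
  rw [← ψ.image_pointMap]
  exact image_mono hFU

/-- The quasi-open perfect map induced by a morphism between algebras of regular closed sets. -/
noncomputable def pointHom : SkePerLC.Hom X Y where
  toFun := ψ.pointMap
  isPerfect := by
    obtain ⟨h1, h2, h3⟩ :=
      isProperMap_iff_isClosedMap_and_compact_fibers.1 ψ.isProperMap_pointMap
    exact ⟨h1, h2, h3⟩
  isQuasiOpen := ψ.isQuasiOpen_pointMap

end ESkePerLC.Hom

end InducedMap

theorem regularClosedFunctor_full : regularClosedFunctor.{u}.Full where
  map_surjective {X Y} ψ := by
    let ψ' : ESkePerLC.Hom X.regularClosed Y.regularClosed := ψ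
    refine ⟨ψ'.pointHom, ESkePerLC.Hom.ext (funext fun F => ?_)⟩
    have h : SkePerLC.Hom.image ψ'.pointHom F = ψ'.onRegularClosed F :=
      SetLike.coe_injective (ψ'.image_pointMap F)
    exact h

/-! ### The space of ends of a local contact algebra -/

section NonTang

variable {B : Type u} [BooleanAlgebra B] {ρ : B → B → Prop}

namespace IsContactRel

variable (h : IsContactRel ρ)
include h

theorem comm {a b : B} : ρ a b ↔ ρ b a := ⟨h.symm a b, h.symm b a⟩

theorem mono_right {a b c : B} (hbc : b ≤ c) (hab : ρ a b) : ρ a c := by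
  rw [← sup_eq_right.2 hbc]
  exact (h.sup_iff a b c).2 (Or.inl hab)

theorem mono_left {a b c : B} (hab : a ≤ b) (hac : ρ a c) : ρ b c :=
  h.symm _ _ (h.mono_right hab (h.symm _ _ hac))

theorem rel_of_inf_ne_bot {a b : B} (hab : a ⊓ b ≠ ⊥) : ρ a b :=
  h.mono_left inf_le_left (h.mono_right inf_le_right (h.refl_of_ne _ hab))

theorem le_of_nonTang {a b : B} (hab : NonTang ρ a b) : a ≤ b := by
  by_contra hle
  exact hab (h.rel_of_inf_ne_bot fun h0 => hle (disjoint_compl_right_iff.1 (disjoint_iff.2 h0)))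

theorem nonTang_mono {a b c d : B} (hab : a ≤ b) (hbc : NonTang ρ b c) (hcd : c ≤ d) :
    NonTang ρ a d :=
  fun had => hbc (h.mono_left hab (h.mono_right (compl_le_compl hcd) had))

theorem nonTang_compl {a b : B} (hab : NonTang ρ a b) : NonTang ρ bᶜ aᶜ := by
  rw [NonTang, compl_compl]
  exact fun hba => hab (h.symm _ _ hba)

theorem nonTang_inf {a b c : B} (hab : NonTang ρ a b) (hac : NonTang ρ a c) :
    NonTang ρ a (b ⊓ c) := by
  rw [NonTang, compl_inf, h.sup_iff]
  exact not_or.2 ⟨hab, hac⟩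

theorem nonTang_top (a : B) : NonTang ρ a ⊤ := by
  rw [NonTang, compl_top]
  exact fun ha => (h.ne_of_rel _ _ ha).2 rfl

end IsContactRel

end NonTang

/-- An end of a local contact algebra: a proper filter `p` such that every element of `p` is
non-tangentially above a bounded element of `p`, and which is prime with respect to `≪`. -/
@[ext]
structure LocalEnd {B : Type u} [BooleanAlgebra B] (ρ : B → B → Prop) (I : Order.Ideal B) :
    Type u where
  /-- the underlying filter -/
  carrier : Set B
  upper : ∀ a b, a ≤ b → a ∈ carrier → b ∈ carrier
  inf_mem : ∀ a b, a ∈ carrier → b ∈ carrier → a ⊓ b ∈ carrier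
  bot_notMem : ⊥ ∉ carrier
  round : ∀ a ∈ carrier, ∃ b ∈ carrier, b ∈ I ∧ NonTang ρ b a
  top_mem : ⊤ ∈ carrier
  prime : ∀ a b, a ∈ I → NonTang ρ a b → aᶜ ∈ carrier ∨ b ∈ carrier

namespace LocalEnd

/-! ### The Hausdorff topology on the set of ends. -/

section Boolean

variable {B : Type u} [BooleanAlgebra B] {ρ : B → B → Prop} {I : Order.Ideal B}

instance : SetLike (LocalEnd ρ I) B where
  coe := carrier
  coe_injective _ _ h := LocalEnd.ext h

variable {p q : LocalEnd ρ I} {a b c : B}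

theorem mem_of_le (hab : a ≤ b) (ha : a ∈ p) : b ∈ p := p.upper a b hab ha

theorem inf_mem_iff : a ⊓ b ∈ p ↔ a ∈ p ∧ b ∈ p :=
  ⟨fun h => ⟨mem_of_le inf_le_left h, mem_of_le inf_le_right h⟩, fun h => p.inf_mem a b h.1 h.2⟩

theorem compl_notMem (ha : a ∈ p) : aᶜ ∉ p := fun h =>
  p.bot_notMem (inf_compl_self a ▸ p.inf_mem _ _ ha h)

theorem exists_bounded_mem (p : LocalEnd ρ I) : ∃ a ∈ p, a ∈ I :=
  let ⟨a, ha, haI, _⟩ := p.round ⊤ p.top_mem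
  ⟨a, ha, haI⟩

variable (ρ I) in
/-- The basic open set of ends containing a given element. -/
def basic (a : B) : Set (LocalEnd ρ I) := {p | a ∈ p}

theorem basic_mono (h : a ≤ b) : basic ρ I a ⊆ basic ρ I b := fun _ => mem_of_le h

theorem basic_inf : basic ρ I (a ⊓ b) = basic ρ I a ∩ basic ρ I b := ext fun _ => inf_mem_iff

theorem basic_bot : basic ρ I ⊥ = ∅ := eq_empty_of_forall_notMem fun p => p.bot_notMem

instance : TopologicalSpace (LocalEnd ρ I) where
  IsOpen U := ∀ p ∈ U, ∃ a ∈ p, basic ρ I a ⊆ U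
  isOpen_univ p _ := ⟨⊤, p.top_mem, subset_univ _⟩
  isOpen_inter U V hU hV p hp := by
    obtain ⟨a, ha, haU⟩ := hU p hp.1
    obtain ⟨b, hb, hbV⟩ := hV p hp.2
    refine ⟨a ⊓ b, p.inf_mem a b ha hb, ?_⟩
    rw [basic_inf]
    exact inter_subset_inter haU hbV
  isOpen_sUnion S hS p := by
    rintro ⟨U, hU, hp⟩
    obtain ⟨a, ha, haU⟩ := hS U hU p hp
    exact ⟨a, ha, haU.trans (subset_sUnion_of_mem hU)⟩

theorem isOpen_iff {U : Set (LocalEnd ρ I)} :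
    IsOpen U ↔ ∀ p ∈ U, ∃ a ∈ p, basic ρ I a ⊆ U := Iff.rfl

theorem isOpen_basic (a : B) : IsOpen (basic ρ I a) :=
  isOpen_iff.2 fun _ hp => ⟨a, hp, Subset.rfl⟩

/-- The closed set of ends adherent to a given element. -/
def adherent (ρ : B → B → Prop) (I : Order.Ideal B) (a : B) : Set (LocalEnd ρ I) :=
  (basic ρ I aᶜ)ᶜ

theorem isClosed_adherent (a : B) : IsClosed (adherent ρ I a) := (isOpen_basic aᶜ).isClosed_compl

theorem basic_subset_adherent (a : B) : basic ρ I a ⊆ adherent ρ I a := fun _ => compl_notMem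

theorem adherent_mono (h : a ≤ b) : adherent ρ I a ⊆ adherent ρ I b :=
  compl_subset_compl.2 (basic_mono (compl_le_compl h))

theorem adherent_subset_basic (ha : a ∈ I) (h : NonTang ρ a b) : adherent ρ I a ⊆ basic ρ I b :=
  fun p hp => (p.prime a b ha h).resolve_left hp

/-- Roundness and primeness make inclusion between ends an equality. -/
theorem exists_mem_notMem (h : p ≠ q) : ∃ a ∈ p, a ∉ q := by
  by_contra! hpq
  refine h (SetLike.coe_injective (Subset.antisymm hpq fun a ha => ?_))
  obtain ⟨b, hb, hbI, hba⟩ := q.round a ha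
  exact (p.prime b a hbI hba).resolve_left fun hbp => compl_notMem hb (hpq _ hbp)

instance : T2Space (LocalEnd ρ I) where
  t2 p q h := by
    obtain ⟨a, ha, haq⟩ := exists_mem_notMem h
    obtain ⟨b, hb, hbI, hba⟩ := p.round a ha
    refine ⟨basic ρ I b, basic ρ I bᶜ, isOpen_basic _, isOpen_basic _, hb,
      (q.prime b a hbI hba).resolve_right haq, ?_⟩
    rw [disjoint_iff_inter_eq_empty, ← basic_inf, inf_compl_self, basic_bot]

end Boolean

/-! ### Existence of ends, contact and compactness. -/

section LocalContact

variable {B : Type u} [BooleanAlgebra B] {ρ : B → B → Prop} {I : Order.Ideal B}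
  (hB : IsLocalContact ρ I)
include hB

/-- The end consisting of the elements non-tangentially above a bounded element of a sufficiently
prime filter of a local contact algebra. -/
def ofUltrafilter (u : Set B) (hbot : ∀ a ∈ u, a ≠ ⊥)
    (hinf : ∀ a ∈ u, ∀ b ∈ u, a ⊓ b ∈ u) (hbd : ∃ a ∈ u, a ∈ I)
    (hprime : ∀ a b, a ∈ I → NonTang ρ a b → aᶜ ∈ u ∨ b ∈ u) : LocalEnd ρ I where
  carrier := {c | ∃ d ∈ u, d ∈ I ∧ NonTang ρ d c}
  upper a b hab := by
    rintro ⟨d, hd, hdI, hda⟩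
    exact ⟨d, hd, hdI, hB.isContactRel.nonTang_mono le_rfl hda hab⟩
  inf_mem a b := by
    rintro ⟨d, hd, hdI, hda⟩ ⟨e, he, -, heb⟩
    exact ⟨d ⊓ e, hinf d hd e he, I.lower inf_le_left hdI, hB.isContactRel.nonTang_inf
      (hB.isContactRel.nonTang_mono inf_le_left hda le_rfl)
      (hB.isContactRel.nonTang_mono inf_le_right heb le_rfl)⟩
  bot_notMem := by
    rintro ⟨d, hd, -, h⟩
    exact hbot d hd (le_bot_iff.1 (hB.isContactRel.le_of_nonTang h))
  round a := by
    rintro ⟨d, hd, hdI, hda⟩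
    obtain ⟨e, heI, hde, hea⟩ := hB.interpolate d a hdI hda
    exact ⟨e, ⟨d, hd, hdI, hde⟩, heI, hea⟩
  top_mem :=
    let ⟨a, ha, haI⟩ := hbd
    ⟨a, ha, haI, hB.isContactRel.nonTang_top a⟩
  prime a b haI hab := by
    -- With `a ≪ e ≪ f ≪ b`, primeness of `u` is used for the middle pair; the outer gaps give `eᶜ ≪
    -- aᶜ` and `f ≪ b`, and meeting with `d` bounds `eᶜ`.
    obtain ⟨e, heI, hae, heb⟩ := hB.interpolate a b haI hab
    obtain ⟨f, hfI, hef, hfb⟩ := hB.interpolate e b heI heb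
    obtain ⟨d, hd, hdI⟩ := hbd
    rcases hprime e f heI hef with h | h
    · exact Or.inl ⟨eᶜ ⊓ d, hinf _ h d hd, I.lower inf_le_right hdI,
        hB.isContactRel.nonTang_mono inf_le_left (hB.isContactRel.nonTang_compl hae) le_rfl⟩
    · exact Or.inr ⟨f, h, hfI, hfb⟩

theorem exists_mem_adherent_of_bounded {a b : B} (hab : ρ a b) (ha : a ∈ I) :
    ∃ p : LocalEnd ρ I, p ∈ adherent ρ I a ∧ p ∈ adherent ρ I b := by
  have hC := hB.isContactRel
  -- A prime ideal containing `J` and avoiding `a` has as complement an ultrafilter containing `a`,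
  -- all of whose elements are in contact with `b`.
  let J : Order.Ideal B :=
    { carrier := {d | ¬ ρ d b}
      lower' := fun x y hyx hx hy => hx (hC.mono_left hyx hy)
      nonempty' := ⟨⊥, fun h => (hC.ne_of_rel _ _ h).1 rfl⟩
      directed' := fun x hx y hy => ⟨x ⊔ y, fun h => by
        rw [hC.comm, hC.sup_iff, hC.comm, hC.comm (a := b)] at h
        exact h.elim hx hy, le_sup_left, le_sup_right⟩ }
  obtain ⟨M, hM, hJM, hd⟩ := DistribLattice.prime_ideal_of_disjoint_filter_ideal
    (F := Order.PFilter.principal a) (I := J) (disjoint_left.2 fun x hx hxJ =>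
      hxJ (hC.mono_left (Order.PFilter.mem_principal.1 hx) hab))
  have haM : a ∉ M := disjoint_left.1 hd (Order.PFilter.mem_principal.2 le_rfl)
  have hcompl : ∀ x, x ∉ M → xᶜ ∈ M := fun x => hM.compl_mem_of_notMem
  have hcompl' : ∀ x, x ∈ M → xᶜ ∉ M := fun x hx hx' => haM
    (M.lower le_top (sup_compl_eq_top (x := x) ▸ Order.Ideal.sup_mem hx hx'))
  refine ⟨ofUltrafilter hB {x | x ∉ M} (fun x hx h => hx (h ▸ M.bot_mem))
    (fun x hx y hy h => (hM.mem_or_mem h).elim hx hy) ⟨a, haM, ha⟩ (fun x y _ hxy => ?_), ?_, ?_⟩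
  · by_cases hx : x ∈ M
    · exact Or.inl (hcompl' x hx)
    · exact Or.inr fun hy => hx (M.lower (hC.le_of_nonTang hxy) hy)
  · rintro ⟨d, hdM, -, hda⟩
    refine hdM (M.lower (hC.le_of_nonTang hda) (hcompl a haM))
  · rintro ⟨d, hdM, -, hdb⟩
    rw [NonTang, compl_compl] at hdb
    exact hdM (hJM hdb)

theorem rel_iff {a b : B} : ρ a b ↔ (adherent ρ I a ∩ adherent ρ I b).Nonempty := by
  have hC := hB.isContactRel
  constructor
  · intro hab
    obtain ⟨c, hc, hcb⟩ := hB.exists_bounded a b hab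
    obtain ⟨p, hp, hpa⟩ := exists_mem_adherent_of_bounded hB (hC.symm _ _ hcb)
      (I.lower inf_le_left hc)
    exact ⟨p, hpa, adherent_mono inf_le_right hp⟩
  · rintro ⟨p, hpa, hpb⟩
    by_contra hab
    -- Primeness of ends applies only to bounded elements, so `a` is cut down by a bounded `d ∈ p`.
    obtain ⟨d, hd, hdI⟩ := p.exists_bounded_mem
    have h : NonTang ρ (d ⊓ a) bᶜ := by
      rw [NonTang, compl_compl]
      exact fun h => hab (hC.mono_left inf_le_right h)
    have hmem := (p.prime _ _ (I.lower inf_le_left hdI) h).resolve_right hpb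
    refine hpa (mem_of_le ?_ (p.inf_mem _ _ hd hmem))
    rw [compl_inf, inf_sup_left, inf_compl_self, bot_sup_eq]
    exact inf_le_right

theorem basic_nonempty {a : B} (ha : a ≠ ⊥) : (basic ρ I a).Nonempty := by
  obtain ⟨b, hbI, hb, hba⟩ := hB.exists_nonTang a ha
  obtain ⟨p, hp, -⟩ := exists_mem_adherent_of_bounded hB (hB.isContactRel.refl_of_ne b hb) hbI
  exact ⟨p, adherent_subset_basic hbI hba hp⟩

theorem closure_basic (a : B) : closure (basic ρ I a) = adherent ρ I a := by
  refine Subset.antisymm (closure_minimal (basic_subset_adherent a) (isClosed_adherent a)) ?_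
  intro p hp
  rw [mem_closure_iff]
  intro U hU hpU
  obtain ⟨c, hc, hcU⟩ := isOpen_iff.1 hU p hpU
  have hca : c ⊓ a ≠ ⊥ := fun h => hp (mem_of_le (le_compl_iff_disjoint_right.2
    (disjoint_iff.2 h)) hc)
  obtain ⟨q, hq⟩ := basic_nonempty hB hca
  rw [basic_inf] at hq
  exact ⟨q, hcU hq.1, hq.2⟩

theorem adherent_subset_iff {a b : B} : adherent ρ I a ⊆ adherent ρ I b ↔ a ≤ b := by
  refine ⟨fun h => ?_, adherent_mono⟩
  by_contra hab
  have hne : a ⊓ bᶜ ≠ ⊥ := fun h0 => hab (by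
    rwa [← disjoint_iff, disjoint_compl_right_iff] at h0)
  obtain ⟨p, hp⟩ := basic_nonempty hB hne
  rw [basic_inf] at hp
  exact h (basic_subset_adherent a hp.1) hp.2

theorem isCompact_adherent {a : B} (ha : a ∈ I) : IsCompact (adherent ρ I a) := by
  rw [isCompact_iff_ultrafilter_le_nhds']
  intro 𝓤 h𝓤
  obtain ⟨d, hdI, had, -⟩ := hB.interpolate a ⊤ ha (hB.isContactRel.nonTang_top a)
  -- The limit of `𝓤`. This filter on `B` need not be an ultrafilter, but it is prime with respect
  -- to `≪`, which suffices.
  let p := ofUltrafilter hB {c | basic ρ I c ∈ 𝓤}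
    (fun c hc h => 𝓤.empty_notMem (by rw [mem_ofPred_eq, h, basic_bot] at hc; exact hc))
    (fun b hb c hc => by rw [mem_ofPred_eq, basic_inf]; exact Filter.inter_mem hb hc)
    ⟨d, Filter.mem_of_superset h𝓤 (adherent_subset_basic ha had), hdI⟩
    (fun b c hb hbc => by
      refine (𝓤.mem_or_compl_mem (basic ρ I c)).symm.imp_left fun h => ?_
      exact Filter.mem_of_superset h fun q hq => (q.prime b c hb hbc).resolve_right hq)
  have hp : (𝓤 : Filter (LocalEnd ρ I)) ≤ 𝓝 p := by
    intro V hV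
    obtain ⟨U, hUV, hU, hpU⟩ := mem_nhds_iff.1 hV
    obtain ⟨c, ⟨e, he, -, hec⟩, hcU⟩ := isOpen_iff.1 hU p hpU
    exact Filter.mem_of_superset he
      ((basic_mono (hB.isContactRel.le_of_nonTang hec)).trans (hcU.trans hUV))
  exact ⟨p, (isClosed_adherent a).mem_of_tendsto hp h𝓤, hp⟩

theorem isCompact_adherent_iff {a : B} : IsCompact (adherent ρ I a) ↔ a ∈ I := by
  refine ⟨fun h => ?_, isCompact_adherent hB⟩
  have : Nonempty I := ⟨⟨⊥, I.bot_mem⟩⟩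
  obtain ⟨b, hb⟩ := h.elim_directed_cover (fun b : I => basic ρ I (b : B))
    (fun b => isOpen_basic _)
    (fun p _ => by
      obtain ⟨b, hb, hbI⟩ := p.exists_bounded_mem
      exact mem_iUnion.2 ⟨⟨b, hbI⟩, hb⟩)
    (fun b c => ⟨⟨b ⊔ c, Order.Ideal.sup_mem b.2 c.2⟩, basic_mono le_sup_left,
      basic_mono le_sup_right⟩)
  exact I.lower ((adherent_subset_iff hB).1 (hb.trans (basic_subset_adherent _))) b.2

theorem locallyCompactSpace : LocallyCompactSpace (LocalEnd ρ I) := by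
  have : WeaklyLocallyCompactSpace (LocalEnd ρ I) := by
    refine ⟨fun p => ?_⟩
    obtain ⟨b, hb, hbI⟩ := p.exists_bounded_mem
    exact ⟨_, isCompact_adherent hB hbI, Filter.mem_of_superset ((isOpen_basic b).mem_nhds hb)
      (basic_subset_adherent b)⟩
  infer_instance

/-- The regular closed set of ends adherent to a given element. -/
def regularClosed (a : B) : RegularClosed (LocalEnd ρ I) where
  carrier := adherent ρ I a
  closure_interior' := by
    rw [← closure_basic hB]
    exact (RegularClosed.ofOpen _ (isOpen_basic a)).closure_interior

theorem coe_regularClosed (a : B) : (regularClosed hB a : Set (LocalEnd ρ I)) = adherent ρ I a :=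
  rfl

end LocalContact

/-! ### Completeness: every regular closed set of ends comes from an element. -/

section Complete

variable {B : Type u} [CompleteBooleanAlgebra B] {ρ : B → B → Prop} {I : Order.Ideal B}
  (hB : IsLocalContact ρ I)
include hB

theorem regularClosed_surjective : Function.Surjective (regularClosed hB) := by
  intro F
  let S := {b : B | basic ρ I b ⊆ interior (F : Set (LocalEnd ρ I))}
  refine ⟨sSup S, SetLike.coe_injective ?_⟩
  rw [coe_regularClosed]
  apply Subset.antisymm
  · rw [← closure_basic hB]
    refine closure_minimal (fun p hp => ?_) F.isClosed
    rw [← F.closure_interior, mem_closure_iff]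
    intro U hU hpU
    obtain ⟨c, hc, hcU⟩ := isOpen_iff.1 hU p hpU
    have hne : c ⊓ sSup S ≠ ⊥ := fun h => p.bot_notMem (h ▸ p.inf_mem _ _ hc hp)
    -- Infinite distributivity passes from the join of `S` to a single member.
    obtain ⟨b, hb, hcb⟩ : ∃ b ∈ S, c ⊓ b ≠ ⊥ := by
      by_contra! hcon
      exact hne (by rw [inf_sSup_eq]; simpa using hcon)
    obtain ⟨q, hq⟩ := basic_nonempty hB hcb
    rw [basic_inf] at hq
    exact ⟨q, hcU hq.1, hb hq.2⟩
  · rw [← F.closure_interior]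
    refine closure_minimal (fun p hp => ?_) (isClosed_adherent _)
    obtain ⟨b, hb, hbF⟩ := isOpen_iff.1 isOpen_interior p hp
    exact basic_subset_adherent _ (mem_of_le (le_sSup hbF) hb)

/-- A complete local contact algebra is isomorphic to the algebra of regular closed sets of its
space of ends. -/
noncomputable def orderIso : B ≃o RegularClosed (LocalEnd ρ I) :=
  RelIso.ofSurjective (OrderEmbedding.ofMapLEIff (regularClosed hB)
    fun _ _ => adherent_subset_iff hB) (regularClosed_surjective hB)

end Complete

end LocalEnd

/-! ### Essential surjectivity and the equivalence. -/

namespace ESkePerLC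

/-- An order isomorphism preserving and reflecting contact and boundedness is a morphism. -/
def homOfOrderIso {A B : ESkePerLC.{u}} (e : A ≃o B)
    (hrel : ∀ a b, A.rel a b ↔ B.rel (e a) (e b))
    (hbd : ∀ a, a ∈ A.bounded ↔ e a ∈ B.bounded) : Hom A B where
  toFun := e
  eq_bot_iff _ := map_eq_bot_iff e
  map_sSup S := by rw [e.map_sSup, sSup_image]
  exists_le a b h := ⟨e.symm b, e.symm_apply_le.2 h, e.apply_symm_apply b⟩
  map_rel a b := (hrel a b).1
  map_bounded a := (hbd a).1
  rightAdj_bounded b hb := by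
    have h : rightAdj e b = e.symm b := by
      refine le_antisymm (sSup_le fun a ha => e.le_symm_apply.2 ha) (le_sSup ?_)
      exact (e.apply_symm_apply b).le
    rw [h, hbd, e.apply_symm_apply]
    exact hb

/-- An order isomorphism preserving and reflecting contact and boundedness is an isomorphism of
complete local contact algebras. -/
def isoOfOrderIso {A B : ESkePerLC.{u}} (e : A ≃o B)
    (hrel : ∀ a b, A.rel a b ↔ B.rel (e a) (e b))
    (hbd : ∀ a, a ∈ A.bounded ↔ e a ∈ B.bounded) : A ≅ B where
  hom := homOfOrderIso e hrel hbd
  inv := homOfOrderIso e.symm (fun a b => by simp [hrel]) (fun a => by simp [hbd])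
  hom_inv_id := Hom.ext (funext e.symm_apply_apply)
  inv_hom_id := Hom.ext (funext e.apply_symm_apply)

/-- The locally compact Hausdorff space of ends of a complete local contact algebra. -/
abbrev endSpace (A : ESkePerLC.{u}) : SkePerLC.{u} :=
  have := LocalEnd.locallyCompactSpace A.isLocalContact
  { carrier := LocalEnd A.rel A.bounded }

/-- A complete local contact algebra is isomorphic to the one of the regular closed sets of its
space of ends. -/
noncomputable def regularClosedEndSpaceIso (A : ESkePerLC.{u}) : A.endSpace.regularClosed ≅ A :=
  (isoOfOrderIso (B := A.endSpace.regularClosed) (LocalEnd.orderIso A.isLocalContact)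
    (fun _ _ => LocalEnd.rel_iff A.isLocalContact)
    (fun _ => (LocalEnd.isCompact_adherent_iff A.isLocalContact).symm)).symm

end ESkePerLC

theorem regularClosedFunctor_essSurj : regularClosedFunctor.{u}.EssSurj where
  mem_essImage A := ⟨A.endSpace, ⟨A.regularClosedEndSpaceIso⟩⟩

theorem regularClosedFunctor_isEquivalence : regularClosedFunctor.{u}.IsEquivalence where
  faithful := regularClosedFunctor_faithful
  full := regularClosedFunctor_full
  essSurj := regularClosedFunctor_essSurj

theorem theorem4p5 : Nonempty (SkePerLC.{u} ≌ ESkePerLC.{u}) :=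
  have := regularClosedFunctor_isEquivalence.{u}
  ⟨regularClosedFunctor.asEquivalence⟩
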